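/- Let $n\ge 0$ and let $M=(m_{ij})$ be a symmetric $n\times n$ matrix with entries in $\{0,1,\ast\}$. An \emph{$M$-partition} of a (simple) graph $G=(V,E)$ is a function $f\colon V\to[n]$ such that for all $u\neq v$ in $V$: if $uv\in E$ then $m_{f(u)f(v)}\in\{1,\ast\}$, and if $uv\notin E$ then $m_{f(u)f(v)}\in\{0,\ast\}$. Let $\mathbb M$ be the $\{R,B\}$-structure on $[n]$ (a $2$-edge-coloured graph) in which $ij$ is a blue edge, $(i,j)\in B$, if and only if $m_{ij}\in\{1,\ast\}$, and a red edge, $(i,j)\in R$, if and only if $m_{ij}\in\{0,\ast\}$. Consider the following decision problems, for fixed $M$. \textbf{Sandwich Problem for $M$-partitions.} Input: two finite graphs $(V,E_1)$, $(V,E_2)$ with $E_1\subseteq E_2$. Question: is there a set $E$ of edges with $E_1\subseteq E\subseteq E_2$ such that $(V,E)$ admits an $M$-partition? \textbf{Sandwich Problem for list $M$-partitions.} Input: as before, together with a list $L(v)\subseteq[n]$ for each $v\in V$. Question: is there a set $E$ of edges with $E_1\subseteq E\subseteq E_2$ such that $(V,E)$ admits an $M$-partition $f$ with $f(v)\in L(v)$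 for all $v\in V$? $\mathrm{CSP}(\mathbb M)$. Input: a finite set $V$ with two binary relations $R,B$. Question: is there a homomorphism to $\mathbb M$, i.e. a map $f\colon V\to[n]$ that sends each pair in $R$ to a red edge of $\mathbb M$ and each pair in $B$ to a blue edge of $\mathbb M$? \textbf{List version of $\mathrm{CSP}(\mathbb M)$.} Input: as for $\mathrm{CSP}(\mathbb M)$, together with a list $L(v)\subseteq[n]$ for each $v\in V$. Question: is there such a homomorphism $f$ with $f(v)\in L(v)$ for all $v\in V$? Two problems are \emph{polynomial-time equivalent} if each has a polynomial-time many-one reduction to the other. Then the following statements hold. 1. The Sandwich Problem for $M$-partitions is polynomial-time equivalent to $\mathrm{CSP}(\mathbb M)$. 2. The Sandwich Problem for list $M$-partitions is polynomial-time equivalent to the list version of $\mathrm{CSP}(\mathbb M)$. -/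

import Mathlib

/-! ### Decision problems and polynomial-time equivalence -/

namespace MatrixSandwich

/-- A decision problem: a type of instances, each written as a word over a finite alphabet in such
a way that different instances get different words, together with the set of yes-instances. -/
structure DecisionProblem where
  Instance : Type
  Symbol : Type
  finite_symbol : Finite Symbol
  encode : Instance → List Symbol
  encode_injective : Function.Injective encode
  yes : Instance → Prop

/-- Polynomial-time many-one reducibility: a function on instances that is computed by a Turing
machine in time polynomial in the length of the input word, and that preserves and reflects
yes-instances. -/
def PolyTimeReduces (P Q : DecisionProblem) : Prop :=
  ∃ f : P.Instance → Q.Instance,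
    Nonempty (Turing.TM2ComputableInPolyTime P.encode Q.encode f) ∧
    ∀ a, P.yes a ↔ Q.yes (f a)

/-- Two problems are polynomial-time equivalent if each one reduces to the other. -/
def PolyTimeEquivalent (P Q : DecisionProblem) : Prop :=
  PolyTimeReduces P Q ∧ PolyTimeReduces Q P

/-! ### Writing a matrix as a word

The matrix is written row by row; row `u` consists of a label of `u` followed by the `k` entries
of the row. The problems without lists use the trivial label `()`, which only marks the beginning
of a row. -/

/-- Row `u` of a labelled `k × k` matrix. -/
def encodeRow {k : ℕ} {L A : Type} (label : Fin k → L) (entry : Fin k → Fin k → A) (u : Fin k) :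
    List (L ⊕ A) :=
  Sum.inl (label u) :: (List.finRange k).map (fun v => Sum.inr (entry u v))

/-- A labelled `k × k` matrix, row by row. -/
def encodeMatrix {k : ℕ} {L A : Type} (label : Fin k → L) (entry : Fin k → Fin k → A) :
    List (L ⊕ A) :=
  (List.finRange k).flatMap (encodeRow label entry)

theorem length_encodeMatrix {k : ℕ} {L A : Type} (label : Fin k → L)
    (entry : Fin k → Fin k → A) : (encodeMatrix label entry).length = k * (k + 1) := by
  simp [encodeMatrix, encodeRow, List.length_flatMap]

theorem flatMap_inj {α β : Type} {m : ℕ} {f g : α → List β} (hf : ∀ a, (f a).length = m)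
    (hg : ∀ a, (g a).length = m) :
    ∀ l : List α, l.flatMap f = l.flatMap g → ∀ a ∈ l, f a = g a
  | [], _ => by simp
  | a :: l, h => by
    rw [List.flatMap_cons, List.flatMap_cons] at h
    obtain ⟨h1, h2⟩ := List.append_inj h ((hf a).trans (hg a).symm)
    intro b hb
    rcases List.mem_cons.1 hb with rfl | hb
    · exact h1
    · exact flatMap_inj hf hg l h2 b hb

theorem size_eq_of_encodeMatrix_eq {k k' : ℕ} {L A : Type} {label : Fin k → L}
    {entry : Fin k → Fin k → A} {label' : Fin k' → L} {entry' : Fin k' → Fin k' → A}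
    (h : encodeMatrix label entry = encodeMatrix label' entry') : k = k' := by
  have h1 := congrArg List.length h
  rw [length_encodeMatrix, length_encodeMatrix] at h1
  rcases lt_trichotomy k k' with hk | hk | hk
  · nlinarith
  · exact hk
  · nlinarith

theorem encodeMatrix_inj {k : ℕ} {L A : Type} {label label' : Fin k → L}
    {entry entry' : Fin k → Fin k → A}
    (h : encodeMatrix label entry = encodeMatrix label' entry') :
    label = label' ∧ entry = entry' := by
  have key : ∀ u, encodeRow label entry u = encodeRow label' entry' u := fun u =>
    flatMap_inj (m := k + 1) (by simp [encodeRow]) (by simp [encodeRow]) _ h u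
      (List.mem_finRange u)
  constructor
  · funext u
    exact Sum.inl.inj (List.cons.inj (key u)).1
  · funext u v
    have h2 := (List.cons.inj (key u)).2
    exact Sum.inr.inj (List.map_inj_left.1 h2 v (List.mem_finRange v))

/-! ### Matrix partitions and their sandwich problems -/

/-- The entries `0`, `1`, `∗`. -/
inductive Entry where
  | zero
  | one
  | star

/-- `f` is an `M`-partition of the graph `G`. -/
def IsPartition {n : ℕ} (M : Matrix (Fin n) (Fin n) Entry) {V : Type} (G : SimpleGraph V)
    (f : V → Fin n) : Prop :=
  ∀ u v : V, u ≠ v →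
    (G.Adj u v → M (f u) (f v) = Entry.one ∨ M (f u) (f v) = Entry.star) ∧
    (¬ G.Adj u v → M (f u) (f v) = Entry.zero ∨ M (f u) (f v) = Entry.star)

/-- A pair of graphs `(V, E₁)`, `(V, E₂)` with `E₁ ⊆ E₂`, on the vertex set `V = {0, …, k - 1}`. -/
structure SandwichInstance where
  k : ℕ
  lower : SimpleGraph (Fin k)
  upper : SimpleGraph (Fin k)
  lower_le_upper : lower ≤ upper

open Classical in
/-- The matrix entry at `(u, v)` records whether `u = v`, `uv ∈ E₁`, and `uv ∈ E₂`. -/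
noncomputable def SandwichInstance.entry (I : SandwichInstance) (u v : Fin I.k) :
    Bool × Bool × Bool :=
  (decide (u = v), decide (I.lower.Adj u v), decide (I.upper.Adj u v))

theorem SandwichInstance.eq_of_encode {L : Type} {I J : SandwichInstance} {l : Fin I.k → L}
    {l' : Fin J.k → L} (h : encodeMatrix l I.entry = encodeMatrix l' J.entry) :
    I = J ∧ HEq l l' := by
  obtain ⟨k, E₁, E₂, hE⟩ := I
  obtain ⟨k', F₁, F₂, hF⟩ := J
  obtain rfl : k = k' := size_eq_of_encodeMatrix_eq h
  obtain ⟨rfl, h2⟩ := encodeMatrix_inj h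
  have e1 : E₁ = F₁ := by
    ext u v
    have := congrFun (congrFun h2 u) v
    simp only [SandwichInstance.entry, Prod.mk.injEq, decide_eq_decide] at this
    exact this.2.1
  have e2 : E₂ = F₂ := by
    ext u v
    have := congrFun (congrFun h2 u) v
    simp only [SandwichInstance.entry, Prod.mk.injEq, decide_eq_decide] at this
    exact this.2.2
  subst e1 e2
  exact ⟨rfl, HEq.rfl⟩

/-- The Sandwich Problem for `M`-partitions: given graphs `(V, E₁)`, `(V, E₂)` with `E₁ ⊆ E₂`, is
there `E` with `E₁ ⊆ E ⊆ E₂` such that `(V, E)` admits an `M`-partition? -/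
noncomputable def sandwichProblem {n : ℕ} (M : Matrix (Fin n) (Fin n) Entry) :
    DecisionProblem where
  Instance := SandwichInstance
  Symbol := Unit ⊕ (Bool × Bool × Bool)
  finite_symbol := inferInstance
  encode I := encodeMatrix (fun _ => ()) I.entry
  encode_injective _ _ h := (SandwichInstance.eq_of_encode h).1
  yes I := ∃ E : SimpleGraph (Fin I.k), I.lower ≤ E ∧ E ≤ I.upper ∧
    ∃ f : Fin I.k → Fin n, IsPartition M E f

/-- A sandwich instance with a list `L(v) ⊆ [n]` for every vertex `v`. -/
structure ListSandwichInstance (n : ℕ) extends SandwichInstance where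
  list : Fin k → Finset (Fin n)

/-- The Sandwich Problem for list `M`-partitions. The label of row `v` is the list `L(v)`. -/
noncomputable def listSandwichProblem {n : ℕ} (M : Matrix (Fin n) (Fin n) Entry) :
    DecisionProblem where
  Instance := ListSandwichInstance n
  Symbol := Finset (Fin n) ⊕ (Bool × Bool × Bool)
  finite_symbol := inferInstance
  encode I := encodeMatrix I.list I.toSandwichInstance.entry
  encode_injective := by
    rintro ⟨I, l⟩ ⟨J, l'⟩ h
    obtain ⟨rfl, h2⟩ := SandwichInstance.eq_of_encode h
    obtain rfl : l = l' := eq_of_heq h2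
    rfl
  yes I := ∃ E : SimpleGraph (Fin I.k), I.lower ≤ E ∧ E ≤ I.upper ∧
    ∃ f : Fin I.k → Fin n, IsPartition M E f ∧ ∀ v, f v ∈ I.list v

/-! ### Structures with two binary relations and their homomorphism problems -/

/-- An `{R, B}`-structure on `V`: two binary relations, red and blue. -/
structure RBStructure (V : Type) where
  red : V → V → Prop
  blue : V → V → Prop

/-- `f` is a homomorphism of `{R, B}`-structures. -/
def RBStructure.IsHom {V W : Type} (G : RBStructure V) (H : RBStructure W) (f : V → W) : Prop :=
  (∀ u v, G.red u v → H.red (f u) (f v)) ∧ (∀ u v, G.blue u v → H.blue (f u) (f v))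

/-- The `2`-edge-coloured graph `𝕄` of a `{0, 1, ∗}`-matrix `M`: the vertices are the indices, `ij`
is a red edge if `m_{ij} ∈ {0, ∗}`, and a blue edge if `m_{ij} ∈ {1, ∗}`. -/
def colouredGraph {n : ℕ} (M : Matrix (Fin n) (Fin n) Entry) : RBStructure (Fin n) where
  red i j := M i j = Entry.zero ∨ M i j = Entry.star
  blue i j := M i j = Entry.one ∨ M i j = Entry.star

/-- A finite `{R, B}`-structure on the vertex set `{0, …, k - 1}`. -/
structure CSPInstance where
  k : ℕ
  str : RBStructure (Fin k)

open Classical in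
/-- The matrix entry at `(u, v)` records the atomic type of the pair: whether `u = v`, and whether
`R(u, v)`, `R(v, u)`, `B(u, v)`, `B(v, u)` hold. -/
noncomputable def CSPInstance.entry (I : CSPInstance) (u v : Fin I.k) :
    Bool × (Bool × Bool) × (Bool × Bool) :=
  (decide (u = v), (decide (I.str.red u v), decide (I.str.red v u)),
    (decide (I.str.blue u v), decide (I.str.blue v u)))

theorem CSPInstance.eq_of_encode {L : Type} {I J : CSPInstance} {l : Fin I.k → L}
    {l' : Fin J.k → L} (h : encodeMatrix l I.entry = encodeMatrix l' J.entry) :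
    I = J ∧ HEq l l' := by
  obtain ⟨k, R, B⟩ := I
  obtain ⟨k', R', B'⟩ := J
  obtain rfl : k = k' := size_eq_of_encodeMatrix_eq h
  obtain ⟨rfl, h2⟩ := encodeMatrix_inj h
  have e1 : R = R' := by
    funext u v
    have := congrFun (congrFun h2 u) v
    simp only [CSPInstance.entry, Prod.mk.injEq, decide_eq_decide] at this
    exact propext this.2.1.1
  have e2 : B = B' := by
    funext u v
    have := congrFun (congrFun h2 u) v
    simp only [CSPInstance.entry, Prod.mk.injEq, decide_eq_decide] at this
    exact propext this.2.2.1
  subst e1 e2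
  exact ⟨rfl, HEq.rfl⟩

/-- `CSP(ℍ)`: given a finite `{R, B}`-structure `𝔾`, is there a homomorphism `𝔾 → ℍ`? -/
noncomputable def csp {n : ℕ} (H : RBStructure (Fin n)) : DecisionProblem where
  Instance := CSPInstance
  Symbol := Unit ⊕ (Bool × (Bool × Bool) × (Bool × Bool))
  finite_symbol := inferInstance
  encode I := encodeMatrix (fun _ => ()) I.entry
  encode_injective _ _ h := (CSPInstance.eq_of_encode h).1
  yes I := ∃ f : Fin I.k → Fin n, I.str.IsHom H f

/-- A finite `{R, B}`-structure with a list `L(v) ⊆ [n]` for every vertex `v`. -/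
structure ListCSPInstance (n : ℕ) extends CSPInstance where
  list : Fin k → Finset (Fin n)

/-- The list version of `CSP(ℍ)`: given a finite `{R, B}`-structure `𝔾` and a list `L(v) ⊆ H` for
every vertex `v`, is there a homomorphism `f : 𝔾 → ℍ` with `f(v) ∈ L(v)` for all `v`? The label of
row `v` is the list `L(v)`. -/
noncomputable def listCsp {n : ℕ} (H : RBStructure (Fin n)) : DecisionProblem where
  Instance := ListCSPInstance n
  Symbol := Finset (Fin n) ⊕ (Bool × (Bool × Bool) × (Bool × Bool))
  finite_symbol := inferInstance
  encode I := encodeMatrix I.list I.toCSPInstance.entry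
  encode_injective := by
    rintro ⟨I, l⟩ ⟨J, l'⟩ h
    obtain ⟨rfl, h2⟩ := CSPInstance.eq_of_encode h
    obtain rfl : l = l' := eq_of_heq h2
    rfl
  yes I := ∃ f : Fin I.k → Fin n, I.str.IsHom H f ∧ ∀ v, f v ∈ I.list v

end MatrixSandwich

/-! Sandwich to CSP. For a fixed `f`, a graph between the two given ones with `f` as an
`M`-partition exists as soon as forced edges go to blue edges of `𝕄` and forced non-edges go to red
ones: every entry of `M` is red or blue, so each undetermined pair can be decided by its entry
(`exists_sandwich_iff`). Hence forced non-edges become red and forced edges become blue.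

CSP to sandwich. The obstacle is a pair that is both red and blue, or a loop: no single pair of
distinct vertices of a sandwich instance can express it. Each vertex is therefore replaced by `m +
1` copies, and the copies of a red-and-blue pair are joined according to a fixed symmetric pattern
`c`. Given a partition of the blow-up, each original vertex receives a value taken by many of its
copies. The pattern is such that between any two such large classes both an edge and a non-edge
occur, so both constraints are recovered (`exists_pattern`, `CSPInstance.exists_iff_toSandwich`).
The chosen value occurs on some copy, so lists are respected.

Since `m` and `c` depend only on `n`, both reductions rewrite a matrix locally: each entry becomes a
block of constant size determined by that entry. One machine with three stacks does this in linear
time (`RowCopy.computable`). -/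

/-! ### A Turing machine that copies the rows of a word -/

namespace MatrixSandwich

open Turing StateTransition

/-- Reachability within a given number of steps. -/
def ReachesWithin {C : Type} (step : C → Option C) (a b : C) (n : ℕ) : Prop :=
  Nonempty (EvalsToInTime step a (some b) n)

namespace ReachesWithin

variable {C : Type} {step : C → Option C} {a b c : C} {m n : ℕ}

theorem trans (h₁ : ReachesWithin step a b m) (h₂ : ReachesWithin step b c n) :
    ReachesWithin step a c (m + n) := by
  obtain ⟨h₁⟩ := h₁
  obtain ⟨h₂⟩ := h₂
  have h := EvalsToInTime.trans step _ _ _ _ _ h₁ h₂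
  rw [Nat.add_comm] at h
  exact ⟨h⟩

theorem single (h : step a = some b) : ReachesWithin step a b 1 :=
  ⟨⟨⟨1, by simpa [flip] using h⟩, le_rfl⟩⟩

theorem mono (h : ReachesWithin step a b m) (hmn : m ≤ n) : ReachesWithin step a b n := by
  obtain ⟨h⟩ := h
  exact ⟨⟨h.toEvalsTo, h.steps_le_m.trans hmn⟩⟩

theorem head (h : step a = some b) (h' : ReachesWithin step b c n) :
    ReachesWithin step a c (n + 1) :=
  ((single h).trans h').mono (by omega)

end ReachesWithin

namespace RowCopy

/-- The word for a sequence of rows, each of which is a label followed by entries. -/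
def rowWord {L A : Type} (r : L × List A) : List (L ⊕ A) :=
  Sum.inl r.1 :: r.2.map Sum.inr

/-- Copy number `i` of a row: every entry `e` is replaced by the entries `t i j e` for `j ≤ m`. -/
def copyRow {L A A' : Type} (m : ℕ) (t : ℕ → ℕ → A → A') (i : ℕ) (r : L × List A) :
    List (L ⊕ A') :=
  Sum.inl r.1 :: r.2.flatMap fun e => (List.range (m + 1)).map fun j => Sum.inr (t i j e)

/-- The stacks of the machine. -/
inductive Stack where
  | input
  | work
  | output
  deriving DecidableEq

instance : Fintype Stack :=
  ⟨{.input, .work, .output}, fun s => by cases s <;> decide⟩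

/-- The alphabets of the stacks. -/
@[reducible] def Alphabet (L A A' : Type) : Stack → Type
  | .input => L ⊕ A
  | .work => L ⊕ A
  | .output => L ⊕ A'

/-- The labels of the machine: `scan i` reads a row backwards from the work stack and writes its
copy number `i`, and `rewind i` moves the input stack to the work stack before `scan i`. -/
inductive Label (m : ℕ) where
  | scan (i : Fin (m + 1))
  | rewind (i : Fin (m + 1))
  deriving Fintype

/-- The contents of the three stacks. -/
def contents {L A A' : Type} (a b : List (L ⊕ A)) (o : List (L ⊕ A')) :
    ∀ s, List (Alphabet L A A' s)
  | .input => a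
  | .work => b
  | .output => o

section Stacks

variable {L A A' : Type} (a b : List (L ⊕ A)) (o : List (L ⊕ A'))

@[simp] theorem contents_input : contents a b o .input = a := rfl
@[simp] theorem contents_work : contents a b o .work = b := rfl
@[simp] theorem contents_output : contents a b o .output = o := rfl

@[simp] theorem update_contents_input (x) :
    Function.update (contents a b o) .input x = contents x b o := by
  funext s; cases s <;> rfl

@[simp] theorem update_contents_work (x) :
    Function.update (contents a b o) .work x = contents a x o := by
  funext s; cases s <;> rfl

@[simp] theorem update_contents_output (x) :
    Function.update (contents a b o) .output x = contents a b x := by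
  funext s; cases s <;> rfl

end Stacks

section Machine

variable {L A A' : Type} [Inhabited L] (m : ℕ) (t : ℕ → ℕ → A → A')

/-- The letter that is written at column `j` of copy number `i`. -/
def letter (i j : ℕ) : Option (L ⊕ A) → L ⊕ A'
  | some (Sum.inl l) => Sum.inl l
  | some (Sum.inr e) => Sum.inr (t i j e)
  -- Never written: the program tests for an empty state before it pushes.
  | none => Sum.inl default

/-- Whether the state holds a label. -/
def isLabel : Option (L ⊕ A) → Bool
  | some (Sum.inl _) => true
  | _ => false

/-- The letter in the state. -/
def held : Option (L ⊕ A) → L ⊕ A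
  | some s => s
  | none => Sum.inl default

/-- Statements of the machine. -/
abbrev Statement (L A A' : Type) (m : ℕ) : Type :=
  TM2.Stmt (Alphabet L A A') (Label m) (Option (L ⊕ A))

/-- Write the letters of columns `< c` of copy number `i`, the last one first. -/
def write (i : ℕ) : ℕ → Statement L A A' m → Statement L A A' m
  | 0, q => q
  | c + 1, q => .push .output (letter t i c) (write i c q)

/-- What to do after the row of copy number `i` has been scanned. -/
def continueWith (i : Fin (m + 1)) (q : Fin (m + 1) → Statement L A A' m)
    (q₀ : Statement L A A' m) : Statement L A A' m :=
  Fin.cases (motive := fun _ => Statement L A A' m) q₀ (fun p => q p.castSucc) i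

/-- The program of the machine. -/
def program : Label m → Statement L A A' m
  | .rewind i =>
    .pop .input (fun _ s => s) <| .branch Option.isNone (.goto fun _ => .scan i) <|
      .push .work held <| .goto fun _ => .rewind i
  | .scan i =>
    .pop .work (fun _ s => s) <| .branch Option.isNone .halt <| .branch isLabel
      -- A label ends the backward scan of a row. The column `0` is a dummy, because labels are
      -- copied unchanged. After copy `0` the preceding row is next; otherwise the row, saved on the
      -- input stack, is rewound for the next lower copy.
      (.push .output (letter t i 0) <| continueWith m i
        (fun p => .push .input held <| .goto fun _ => .rewind p) (.goto fun _ => .scan (Fin.last m)))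
      (write m t i (m + 1) <| continueWith m i
        (fun _ => .push .input held <| .goto fun _ => .scan i) (.goto fun _ => .scan i))

/-- Configurations of the machine. -/
def config (l : Option (Label m)) (v : Option (L ⊕ A)) (a b : List (L ⊕ A)) (o : List (L ⊕ A')) :
    TM2.Cfg (Alphabet L A A') (Label m) (Option (L ⊕ A)) :=
  ⟨l, v, contents a b o⟩

/-- The machine reaches the second configuration from the first one in at most `n` steps. -/
abbrev Runs (c c' : TM2.Cfg (Alphabet L A A') (Label m) (Option (L ⊕ A))) (n : ℕ) : Prop :=
  ReachesWithin (TM2.step (program m t)) c c' n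

variable {m t}

/-! ### Correctness and running time of the machine -/

theorem stepAux_write (i c : ℕ) (q : Statement L A A' m) (e : A) (a b : List (L ⊕ A))
    (o : List (L ⊕ A')) :
    TM2.stepAux (write m t i c q) (some (Sum.inr e)) (contents a b o) =
      TM2.stepAux q (some (Sum.inr e))
        (contents a b (((List.range c).map fun j => Sum.inr (t i j e)) ++ o)) := by
  induction c generalizing o with
  | zero => simp [write]
  | succ c ih => simp [write, ih, letter, List.range_succ]

theorem runs_rewind (i : Fin (m + 1)) (v : Option (L ⊕ A)) (a b : List (L ⊕ A))
    (o : List (L ⊕ A')) :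
    Runs m t (config m (some (.rewind i)) v a b o)
      (config m (some (.scan i)) none [] (a.reverse ++ b) o) (a.length + 1) := by
  induction a generalizing v b with
  | nil => exact .single (by simp [config, program])
  | cons s a ih =>
    refine .head (b := config m (some (.rewind i)) (some s) a (s :: b) o) ?_ ?_
    · simp [config, program, held]
    · simpa using ih (some s) (s :: b)

/-- The output stack grows at its front, so rows are consumed backwards, with the label last. Copy
`0` is the last one produced, so the row is not saved on the input stack. -/
theorem runs_scan_zero (v : Option (L ⊕ A)) (es : List A) (l : L) (b : List (L ⊕ A))
    (o : List (L ⊕ A')) :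
    Runs m t (config m (some (.scan 0)) v [] (es.map Sum.inr ++ Sum.inl l :: b) o)
      (config m (some (.scan (Fin.last m))) (some (Sum.inl l)) [] b
        (copyRow m t 0 (l, es.reverse) ++ o)) (es.length + 1) := by
  induction es generalizing v o with
  | nil => exact .single (by simp [config, program, continueWith, isLabel, letter, copyRow])
  | cons e es ih =>
    refine .head (b := config m (some (.scan 0)) (some (Sum.inr e)) []
      (es.map Sum.inr ++ Sum.inl l :: b)
      (((List.range (m + 1)).map fun j => Sum.inr (t 0 j e)) ++ o)) ?_ ?_
    · simp [config, program, isLabel, stepAux_write, continueWith]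
    · simpa [copyRow] using ih (some (Sum.inr e)) _

theorem runs_scan_succ (p : Fin m) (v : Option (L ⊕ A)) (es : List A) (l : L)
    (a b : List (L ⊕ A)) (o : List (L ⊕ A')) :
    Runs m t (config m (some (.scan p.succ)) v a (es.map Sum.inr ++ Sum.inl l :: b) o)
      (config m (some (.rewind p.castSucc)) (some (Sum.inl l)) (rowWord (l, es.reverse) ++ a) b
        (copyRow m t (p + 1) (l, es.reverse) ++ o)) (es.length + 1) := by
  induction es generalizing v a o with
  | nil =>
    exact .single (by simp [config, program, continueWith, isLabel, letter, copyRow, rowWord, held])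
  | cons e es ih =>
    refine .head (b := config m (some (.scan p.succ)) (some (Sum.inr e)) (Sum.inr e :: a)
      (es.map Sum.inr ++ Sum.inl l :: b)
      (((List.range (m + 1)).map fun j => Sum.inr (t (p + 1) j e)) ++ o)) ?_ ?_
    · simp [config, program, isLabel, stepAux_write, continueWith, held]
    · simpa [copyRow, rowWord] using ih (some (Sum.inr e)) _ _

/-- Copies are produced in decreasing order, so that they stand in increasing order on the output
stack. Each copy with positive number costs a scan and a rewind; copy `0` costs only a scan. -/
theorem runs_row (i : Fin (m + 1)) (v : Option (L ⊕ A)) (r : L × List A) (b : List (L ⊕ A))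
    (o : List (L ⊕ A')) :
    Runs m t (config m (some (.scan i)) v [] ((rowWord r).reverse ++ b) o)
      (config m (some (.scan (Fin.last m))) (some (Sum.inl r.1)) [] b
        ((List.range (i + 1)).flatMap (fun j => copyRow m t j r) ++ o))
      ((3 * i + 1) * (rowWord r).length) := by
  obtain ⟨l, es⟩ := r
  induction i using Fin.induction generalizing v o with
  | zero => simpa [rowWord, ← List.map_reverse] using runs_scan_zero v es.reverse l b o
  | succ p ih =>
    have h₁ := runs_scan_succ (t := t) p v es.reverse l [] b o
    have h₂ := runs_rewind (t := t) p.castSucc (some (Sum.inl l)) (rowWord (l, es)) b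
      (copyRow m t (p + 1) (l, es) ++ o)
    have h₃ := ih none (copyRow m t (p + 1) (l, es) ++ o)
    rw [List.reverse_reverse, List.append_nil] at h₁
    have h := (h₁.trans h₂).trans h₃
    have e : (List.map Sum.inr es.reverse ++ Sum.inl l :: b : List (L ⊕ A)) =
        (rowWord (l, es)).reverse ++ b := by simp [rowWord]
    rw [e] at h
    rw [Fin.val_succ, List.range_succ, List.flatMap_append, List.append_assoc,
      List.flatMap_singleton]
    -- A scan and a rewind take `2 * ℓ + 1 ≤ 3 * ℓ` steps for a row word of length `ℓ`, which is
    -- positive because of the label.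
    refine h.mono ?_
    simp only [rowWord, List.length_cons, List.length_map, List.length_reverse, Fin.val_castSucc]
    ring_nf
    omega

theorem runs_rows (v : Option (L ⊕ A)) (rs : List (L × List A)) (o : List (L ⊕ A')) :
    Runs m t (config m (some (.scan (Fin.last m))) v [] (rs.flatMap rowWord).reverse o)
      (config m none none [] []
        (rs.flatMap (fun r => (List.range (m + 1)).flatMap fun j => copyRow m t j r) ++ o))
      ((3 * m + 1) * (rs.flatMap rowWord).length + 1) := by
  induction rs using List.reverseRecOn generalizing v o with
  | nil => exact .single (by simp [config, program])
  | append_singleton rs r ih =>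
    have h := (runs_row (t := t) (Fin.last m) v r (rs.flatMap rowWord).reverse o).trans (ih _ _)
    simp only [List.flatMap_append, List.reverse_append, List.flatMap_singleton, List.append_assoc,
      List.length_append]
    refine h.mono ?_
    rw [Fin.val_last]
    ring_nf
    omega

theorem runs_main (rs : List (L × List A)) :
    Runs m t (config m (some (.rewind (Fin.last m))) none (rs.flatMap rowWord) [] [])
      (config m none none [] []
        (rs.flatMap (fun r => (List.range (m + 1)).flatMap fun j => copyRow m t j r)))
      ((3 * m + 2) * (rs.flatMap rowWord).length + 2) := by
  have h := (runs_rewind (t := t) (Fin.last m) none (rs.flatMap rowWord) [] []).trans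
    (by simpa only [List.append_nil] using runs_rows (t := t) none rs [])
  refine h.mono ?_
  ring_nf
  omega

variable (m t) in
/-- The machine. -/
def machine [Fintype L] [Fintype A] : FinTM2 where
  K := Stack
  k₀ := .input
  k₁ := .output
  Γ := Alphabet L A A'
  Λ := Label m
  main := .rewind (Fin.last m)
  σ := Option (L ⊕ A)
  initialState := none
  Γk₀Fin := inferInstanceAs (Fintype (L ⊕ A))
  m := program m t

variable (m t) in
/-- A function that copies the rows of the input word is computable in polynomial time. -/
theorem computable [Fintype L] [Fintype A] {α β : Type} (ea : α → List (L ⊕ A))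
    (eb : β → List (L ⊕ A')) (f : α → β) (rows : α → List (L × List A))
    (hea : ∀ a, ea a = (rows a).flatMap rowWord)
    (heb : ∀ a, eb (f a) =
      (rows a).flatMap fun r => (List.range (m + 1)).flatMap fun j => copyRow m t j r) :
    Nonempty (TM2ComputableInPolyTime ea eb f) := by
  refine ⟨⟨⟨machine m t, Equiv.refl (L ⊕ A), Equiv.refl (L ⊕ A')⟩,
    Polynomial.C (3 * m + 2) * Polynomial.X + Polynomial.C 2, fun a => Classical.choice ?_⟩⟩
  have h := runs_main (t := t) (m := m) (rows a)
  rw [← hea, ← heb] at h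
  have e₁ : initList (machine m t) (List.map (Equiv.refl (L ⊕ A)).invFun (ea a)) =
      config m (some (.rewind (Fin.last m))) none (ea a) [] [] := by
    simp only [initList, config]
    congr 1
    funext s
    cases s
    · exact List.map_id _
    · rfl
    · rfl
  have e₂ : haltList (machine m t) (List.map (Equiv.refl (L ⊕ A')).invFun (eb (f a))) =
      config m none none [] [] (eb (f a)) := by
    simp only [haltList, config]
    congr 1
    funext s
    cases s
    · rfl
    · rfl
    · exact List.map_id _
  simp only [TM2OutputsInTime, Option.map_some, Polynomial.eval_add, Polynomial.eval_mul,
    Polynomial.eval_C, Polynomial.eval_X]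
  rw [e₁, e₂]
  exact h

end Machine

end RowCopy

end MatrixSandwich

/-! ### A symmetric pattern without large monochromatic rectangles -/

namespace MatrixSandwich

namespace Pattern

/-- The colour of a pair of indices. -/
def colour {X : Type} (s t : X × (X → Bool)) : Bool := xor (s.2 t.1) (t.2 s.1)

theorem colour_comm {X : Type} (s t : X × (X → Bool)) : colour s t = colour t s :=
  Bool.xor_comm _ _

theorem exists_large_fiber {I : Type} [Fintype I] [Nonempty I] {n : ℕ} (φ : I → Fin n) :
    ∃ a, Fintype.card I ≤ n * (Finset.univ.filter fun i => φ i = a).card := by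
  have : Nonempty (Fin n) := ⟨φ (Classical.arbitrary I)⟩
  obtain ⟨a, -, ha⟩ := Finset.exists_le_of_sum_le (s := Finset.univ) (Finset.univ_nonempty)
    (f := fun _ : Fin n => Fintype.card I)
    (g := fun a => n * (Finset.univ.filter fun i => φ i = a).card) (by
      rw [← Finset.mul_sum, ← Finset.card_eq_sum_card_fiberwise (f := φ) (by simp)]
      simp)
  exact ⟨a, ha⟩

/-- A set of Boolean functions that agree on `Y` has at most `2 ^ (|X| - |Y|)` elements. -/
theorem card_mul_two_pow_le {X : Type} [Fintype X] [DecidableEq X] (Y : Finset X)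
    (S : Finset (X → Bool)) (h : X → Bool) (hS : ∀ g ∈ S, ∀ y ∈ Y, g y = h y) :
    S.card * 2 ^ Y.card ≤ 2 ^ Fintype.card X := by
  have hinj : S.card ≤ (Finset.univ : Finset ({x // x ∉ Y} → Bool)).card := by
    refine Finset.card_le_card_of_injOn (fun g x => g x) (by simp) fun g hg g' hg' e => ?_
    funext x
    by_cases hx : x ∈ Y
    · rw [hS g hg x hx, hS g' hg' x hx]
    · exact congrFun e ⟨x, hx⟩
  have hc : Fintype.card {x // x ∉ Y} + Y.card = Fintype.card X := by
    rw [Fintype.card_subtype_compl, Fintype.card_coe]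
    exact Nat.sub_add_cancel (Finset.card_le_univ Y)
  calc S.card * 2 ^ Y.card ≤ 2 ^ Fintype.card {x // x ∉ Y} * 2 ^ Y.card := by
        gcongr
        simpa using hinj
    _ = 2 ^ Fintype.card X := by rw [← pow_add, hc]

/-- If the colour `b` were missing, then for `(x, g) ∈ S` and `(y, h) ∈ T` with `y ≠ x` the value `g
y` would be determined by `h x`. As `T` is large, it meets many first coordinates `y`; as `S` is
large, some `x` carries many functions `g`. But fixing `g` at many points leaves too few functions.
-/
theorem exists_colour_eq {X : Type} [Fintype X] [DecidableEq X] {n : ℕ}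
    (hX : Fintype.card X = n * (n + 1) + 1) (S T : Finset (X × (X → Bool)))
    (hS : Fintype.card (X × (X → Bool)) ≤ n * S.card)
    (hT : Fintype.card (X × (X → Bool)) ≤ n * T.card) (b : Bool) :
    ∃ s ∈ S, ∃ t ∈ T, s ≠ t ∧ colour s t = b := by
  by_contra! hcon
  have hcard : Fintype.card (X × (X → Bool)) = Fintype.card X * 2 ^ Fintype.card X := by simp
  rw [hcard] at hS hT
  have : Nonempty X := Fintype.card_pos_iff.1 (by omega)
  set q := Fintype.card X with hq
  set Y := T.image Prod.fst with hY
  -- Each first coordinate carries at most `2 ^ q` elements of `T`, hence `q ≤ n * Y.card`; this is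
  -- where `q = n * (n + 1) + 1` is needed.
  have hYcard : n + 1 < Y.card := by
    have h1 : T.card ≤ Y.card * 2 ^ q := by
      have : T ⊆ Y ×ˢ (Finset.univ : Finset (X → Bool)) := fun t ht =>
        Finset.mem_product.2 ⟨Finset.mem_image_of_mem _ ht, Finset.mem_univ _⟩
      simpa [← hq] using Finset.card_le_card this
    have h2 : q * 2 ^ q ≤ (n * Y.card) * 2 ^ q := by
      calc q * 2 ^ q ≤ n * T.card := hT
        _ ≤ n * (Y.card * 2 ^ q) := by gcongr
        _ = _ := by ring
    have h3 : q ≤ n * Y.card := Nat.le_of_mul_le_mul_right h2 (by positivity)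
    by_contra! h4
    have := Nat.mul_le_mul_left n h4
    omega
  -- Averaging over first coordinates: some fibre of `S` contains at least a fraction `1 / n` of all
  -- functions.
  obtain ⟨x, -, hx⟩ := Finset.exists_le_of_sum_le (s := Finset.univ) (Finset.univ_nonempty)
    (f := fun _ : X => 2 ^ q) (g := fun x => n * (S.filter fun s => s.1 = x).card) (by
      rw [← Finset.mul_sum, ← Finset.card_eq_sum_card_fiberwise (f := Prod.fst) (by simp)]
      simpa [← hq] using hS)
  have hex : ∀ y, ∃ h : X → Bool, y ∈ Y → (y, h) ∈ T := fun y => by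
    by_cases hy : y ∈ Y
    · obtain ⟨⟨_, h⟩, ht, rfl⟩ := Finset.mem_image.1 hy
      exact ⟨h, fun _ => ht⟩
    · exact ⟨fun _ => false, fun h => absurd h hy⟩
  choose h hh using hex
  -- The absence of `b` forces `xor (g y) (h y x) = !b`. The point `x` is erased because the pair
  -- with `y = x` might consist of equal elements.
  have key := card_mul_two_pow_le (Y.erase x) ((S.filter fun s => s.1 = x).image Prod.snd)
    (fun y => xor (!b) (h y x)) (by
      intro g hg y hy
      obtain ⟨⟨x', g⟩, hs, rfl⟩ := Finset.mem_image.1 hg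
      obtain ⟨hs', rfl⟩ := Finset.mem_filter.1 hs
      obtain ⟨hyx, hyY⟩ := Finset.mem_erase.1 hy
      have := hcon _ hs' _ (hh y hyY) (fun e => hyx (congrArg Prod.fst e).symm)
      simp only [colour] at this ⊢
      revert this
      cases b <;> cases g y <;> cases h y x' <;> simp)
  rw [Finset.card_image_of_injOn (by
    rintro ⟨x₁, g₁⟩ h₁ ⟨x₂, g₂⟩ h₂ e
    have e₁ := (Finset.mem_filter.1 h₁).2
    have e₂ := (Finset.mem_filter.1 h₂).2
    exact Prod.ext (e₁.trans e₂.symm) e)] at key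
  have hle : n ≤ (Y.erase x).card := by
    have := Finset.pred_card_le_card_erase (s := Y) (a := x)
    omega
  have h5 : 2 ^ q * 2 ^ n ≤ n * 2 ^ q := by
    calc 2 ^ q * 2 ^ n ≤ (n * (S.filter fun s => s.1 = x).card) * 2 ^ (Y.erase x).card :=
          Nat.mul_le_mul hx (Nat.pow_le_pow_right (by norm_num) hle)
      _ = n * ((S.filter fun s => s.1 = x).card * 2 ^ (Y.erase x).card) := by ring
      _ ≤ n * 2 ^ q := by gcongr
  have h6 : 2 ^ n ≤ n := by
    rw [mul_comm] at h5
    exact Nat.le_of_mul_le_mul_right h5 (by positivity)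
  exact absurd h6 (not_le.2 Nat.lt_two_pow_self)

end Pattern

/-- A symmetric `2`-colouring `c` of the pairs of copies and a selection of a colour class from
every colouring of the copies, such that between any two selected classes both colours occur. -/
theorem exists_pattern (n : ℕ) : ∃ (m : ℕ) (c : ℕ → ℕ → Bool) (sel : (Fin (m + 1) → Fin n) → Fin n),
    (∀ i j, c i j = c j i) ∧ ∀ φ ψ b, ∃ i j : Fin (m + 1),
      i ≠ j ∧ φ i = sel φ ∧ ψ j = sel ψ ∧ c i j = b := by
  let X := Fin (n * (n + 1) + 1)
  obtain ⟨m, hm⟩ : ∃ m, Fintype.card (X × (X → Bool)) = m + 1 :=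
    Nat.exists_eq_succ_of_ne_zero Fintype.card_ne_zero
  let e : Fin (m + 1) ≃ X × (X → Bool) := (Fintype.equivFinOfCardEq hm).symm
  choose sel hsel using fun φ : Fin (m + 1) → Fin n => Pattern.exists_large_fiber (φ ∘ e.symm)
  -- `Fin.ofNat` merely extends the pattern to all natural numbers; only indices up to `m` matter.
  refine ⟨m, fun i j => Pattern.colour (e (Fin.ofNat (m + 1) i)) (e (Fin.ofNat (m + 1) j)), sel,
    fun i j => Pattern.colour_comm _ _, fun φ ψ b => ?_⟩
  obtain ⟨s, hs, t, ht, hst, hc⟩ :=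
    Pattern.exists_colour_eq (Fintype.card_fin _) _ _ (hsel φ) (hsel ψ) b
  refine ⟨e.symm s, e.symm t, fun h => hst (e.symm.injective h), (Finset.mem_filter.1 hs).2,
    (Finset.mem_filter.1 ht).2, ?_⟩
  simpa using hc

end MatrixSandwich

/-! ### Blow-ups -/

namespace MatrixSandwich

namespace Blowup

/-- The original vertex of a copy. -/
def base {k N : ℕ} (x : Fin (k * N)) : Fin k := x.divNat

/-- The number of a copy. -/
def idx {k N : ℕ} (x : Fin (k * N)) : Fin N := x.modNat

/-- The copy number `i` of the vertex `u`. -/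
def copy {k N : ℕ} (u : Fin k) (i : Fin N) : Fin (k * N) := finProdFinEquiv (u, i)

@[simp] theorem base_copy {k N : ℕ} (u : Fin k) (i : Fin N) : base (copy u i) = u :=
  congrArg Prod.fst (finProdFinEquiv.symm_apply_apply (u, i))

@[simp] theorem idx_copy {k N : ℕ} (u : Fin k) (i : Fin N) : idx (copy u i) = i :=
  congrArg Prod.snd (finProdFinEquiv.symm_apply_apply (u, i))

theorem eq_iff {k N : ℕ} (x y : Fin (k * N)) : x = y ↔ base x = base y ∧ idx x = idx y := by
  rw [← finProdFinEquiv.symm.injective.eq_iff]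
  exact Prod.ext_iff

/-- The copies of a vertex are numbered consecutively, so they form a block in the enumeration. -/
theorem map_finRange_mul {α : Type} {k N : ℕ} (F : Fin (k * N) → α) :
    (List.finRange (k * N)).map F =
      (List.finRange k).flatMap fun u => (List.finRange N).map fun i => F (copy u i) := by
  rw [← List.ofFn_eq_map, List.ofFn_mul, List.flatMap, List.ofFn_eq_map]
  congr 1
  refine List.map_congr_left fun u _ => ?_
  rw [List.ofFn_eq_map]
  refine List.map_congr_left fun i _ => congrArg F (Fin.ext ?_)
  simp [copy, Nat.mul_comm, Nat.add_comm]

theorem flatMap_finRange_mul {α : Type} {k N : ℕ} (F : Fin (k * N) → List α) :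
    (List.finRange (k * N)).flatMap F =
      (List.finRange k).flatMap fun u => (List.finRange N).flatMap fun i => F (copy u i) := by
  rw [List.flatMap, map_finRange_mul, List.flatMap, List.flatMap, List.flatten_flatten,
    List.map_map]
  rfl

/-- The rows of a labelled matrix. -/
def rows {k : ℕ} {L A : Type} (label : Fin k → L) (entry : Fin k → Fin k → A) :
    List (L × List A) :=
  (List.finRange k).map fun u => (label u, (List.finRange k).map (entry u))

theorem encodeMatrix_eq_rows {k : ℕ} {L A : Type} (label : Fin k → L)
    (entry : Fin k → Fin k → A) :
    encodeMatrix label entry = (rows label entry).flatMap RowCopy.rowWord := by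
  simp only [encodeMatrix, rows, List.flatMap_map]
  exact List.flatMap_congr fun u _ => by simp [encodeRow, RowCopy.rowWord]

/-- This links matrices to the machine: if a new entry depends only on the two copy numbers and the
old entry, the word of the blow-up is the one obtained by copying rows. -/
theorem encodeMatrix_blowup {k m : ℕ} {L A A' : Type} (t : ℕ → ℕ → A → A') (label : Fin k → L)
    (entry : Fin k → Fin k → A) (entry' : Fin (k * (m + 1)) → Fin (k * (m + 1)) → A')
    (h : ∀ x y, entry' x y = t (idx x) (idx y) (entry (base x) (base y))) :
    encodeMatrix (fun x => label (base x)) entry' = (rows label entry).flatMap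
      fun r => (List.range (m + 1)).flatMap fun j => RowCopy.copyRow m t j r := by
  rw [encodeMatrix, flatMap_finRange_mul, rows, List.flatMap_map]
  refine List.flatMap_congr fun u _ => ?_
  rw [← List.map_coe_finRange_eq_range, List.flatMap_map]
  refine List.flatMap_congr fun i _ => ?_
  rw [encodeRow, RowCopy.copyRow, map_finRange_mul, List.flatMap_map]
  simp only [h, base_copy, idx_copy, ← List.map_coe_finRange_eq_range, List.map_map]
  rfl

theorem computable {m : ℕ} {L A A' : Type} [Inhabited L] [Fintype L] [Fintype A]
    (t : ℕ → ℕ → A → A') {P Q : Type} (k : P → ℕ) (label : ∀ I, Fin (k I) → L)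
    (entry : ∀ I, Fin (k I) → Fin (k I) → A) (eb : Q → List (L ⊕ A')) (f : P → Q)
    (entry' : ∀ I, Fin (k I * (m + 1)) → Fin (k I * (m + 1)) → A')
    (hf : ∀ I, eb (f I) = encodeMatrix (fun x => label I (base x)) (entry' I))
    (h : ∀ I x y, entry' I x y = t (idx x) (idx y) (entry I (base x) (base y))) :
    Nonempty (Turing.TM2ComputableInPolyTime (fun I => encodeMatrix (label I) (entry I)) eb f) :=
  RowCopy.computable m t _ _ f (fun I => rows (label I) (entry I))
    (fun _ => encodeMatrix_eq_rows _ _)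
    (fun I => (hf I).trans (encodeMatrix_blowup t _ _ _ (h I)))

end Blowup

/-! ### The reductions -/

section Reductions

open Blowup

variable {n : ℕ} {M : Matrix (Fin n) (Fin n) Entry}

/-- Only forced pairs constrain `f`: an undetermined pair may be made an edge or a non-edge, and
each entry of `M` permits at least one of the two. -/
theorem exists_sandwich_iff (hM : M.IsSymm) {V : Type} {lower upper : SimpleGraph V}
    (hle : lower ≤ upper) (f : V → Fin n) :
    (∃ E, lower ≤ E ∧ E ≤ upper ∧ IsPartition M E f) ↔ ∀ u v, u ≠ v →
      (lower.Adj u v → (colouredGraph M).blue (f u) (f v)) ∧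
      (¬ upper.Adj u v → (colouredGraph M).red (f u) (f v)) := by
  constructor
  · rintro ⟨E, h₁, h₂, hE⟩ u v huv
    exact ⟨fun h => (hE u v huv).1 (h₁ h), fun h => (hE u v huv).2 fun h' => h (h₂ h')⟩
  · intro h
    -- Optional pairs become edges exactly when their entry is `1`; the entry `∗` would permit
    -- either choice. Symmetry of `M` makes this a graph.
    refine ⟨{ Adj := fun u v => lower.Adj u v ∨ upper.Adj u v ∧ M (f u) (f v) = Entry.one
              symm := ⟨fun u v huv => ?_⟩
              loopless := ⟨fun u hu => ?_⟩ }, fun u v => Or.inl, ?_, fun u v huv => ⟨?_, ?_⟩⟩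
    · rw [hM.apply]
      exact huv.imp (fun h => h.symm) (fun h => ⟨h.1.symm, h.2⟩)
    · rcases hu with hu | hu
      · exact lower.loopless.irrefl u hu
      · exact upper.loopless.irrefl u hu.1
    · rintro u v (huv | huv)
      · exact hle huv
      · exact huv.1
    · rintro (h' | h')
      · exact (h u v huv).1 h'
      · exact Or.inl h'.2
    · intro h'
      by_cases hu : upper.Adj u v
      · have : M (f u) (f v) ≠ Entry.one := fun e => h' (Or.inr ⟨hu, e⟩)
        cases e : M (f u) (f v) <;> simp_all
      · exact (h u v huv).2 hu

theorem red_comm (hM : M.IsSymm) {i j : Fin n} (h : (colouredGraph M).red i j) :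
    (colouredGraph M).red j i := by
  simpa only [colouredGraph, hM.apply] using h

theorem blue_comm (hM : M.IsSymm) {i j : Fin n} (h : (colouredGraph M).blue i j) :
    (colouredGraph M).blue j i := by
  simpa only [colouredGraph, hM.apply] using h

theorem SandwichInstance.entry_eq {I : SandwichInstance} {x y : Fin I.k} {e l u : Bool}
    (he : x = y ↔ e = true) (hl : I.lower.Adj x y ↔ l = true) (hu : I.upper.Adj x y ↔ u = true) :
    I.entry x y = (e, l, u) := by
  simp [SandwichInstance.entry, he, hl, hu]

theorem CSPInstance.entry_eq {I : CSPInstance} {x y : Fin I.k} {e r r' b b' : Bool}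
    (he : x = y ↔ e = true) (hr : I.str.red x y ↔ r = true) (hr' : I.str.red y x ↔ r' = true)
    (hb : I.str.blue x y ↔ b = true) (hb' : I.str.blue y x ↔ b' = true) :
    I.entry x y = (e, (r, r'), (b, b')) := by
  simp [CSPInstance.entry, he, hr, hr', hb, hb']

/-! ### From sandwich instances to structures -/

/-- The structure whose red edges are the forced non-edges and whose blue edges are the forced
edges of a sandwich instance. -/
def SandwichInstance.toCSP (I : SandwichInstance) : CSPInstance where
  -- The vertex set is unchanged up to this blow-up with one copy, which gives it the shape that
  -- `Blowup.computable` expects.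
  k := I.k * (0 + 1)
  str.red x y := base x ≠ base y ∧ ¬ I.upper.Adj (base x) (base y)
  str.blue x y := I.lower.Adj (base x) (base y)

/-- The effect of `SandwichInstance.toCSP` on matrix entries. -/
def toCSPEntry : Bool × Bool × Bool → Bool × (Bool × Bool) × (Bool × Bool)
  | (e, l, u) => (e, (!e && !u, !e && !u), (l, l))

theorem SandwichInstance.entry_toCSP (I : SandwichInstance) (x y : Fin (I.k * (0 + 1))) :
    I.toCSP.entry x y = toCSPEntry (I.entry (base x) (base y)) := by
  classical
  have h1 : (x = y) ↔ base x = base y := by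
    rw [eq_iff, and_iff_left (Subsingleton.elim (α := Fin 1) _ _)]
  have h2 : (base x ≠ base y ∧ ¬ I.upper.Adj (base x) (base y)) ↔
      (!decide (base x = base y) && !decide (I.upper.Adj (base x) (base y))) = true := by simp
  have h3 : I.lower.Adj (base x) (base y) ↔ decide (I.lower.Adj (base x) (base y)) = true := by simp
  have key := CSPInstance.entry_eq (I := I.toCSP) (h1.trans decide_eq_true_iff.symm) h2
    ((and_congr ne_comm (not_congr (I.upper.adj_comm _ _))).trans h2) h3
    ((I.lower.adj_comm _ _).trans h3)
  rw [key, SandwichInstance.entry, toCSPEntry]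

/-- Partitions of a sandwich instance are the homomorphisms of the associated structure. -/
theorem SandwichInstance.exists_iff_toCSP (hM : M.IsSymm) (I : SandwichInstance)
    (l : Fin I.k → Set (Fin n)) :
    (∃ E, I.lower ≤ E ∧ E ≤ I.upper ∧ ∃ f, IsPartition M E f ∧ ∀ v, f v ∈ l v) ↔
      ∃ f : Fin I.toCSP.k → Fin n, I.toCSP.str.IsHom (colouredGraph M) f ∧
        ∀ x, f x ∈ l (base x) := by
  constructor
  · rintro ⟨E, h₁, h₂, f, hf, hl⟩
    have h := (exists_sandwich_iff hM I.lower_le_upper f).1 ⟨E, h₁, h₂, hf⟩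
    exact ⟨fun x => f (base x), ⟨fun x y hxy => (h _ _ hxy.1).2 hxy.2,
      fun x y hxy => (h _ _ hxy.ne).1 hxy⟩, fun x => hl _⟩
  · rintro ⟨f, hf, hl⟩
    obtain ⟨E, h₁, h₂, h₃⟩ := (exists_sandwich_iff hM I.lower_le_upper
      fun u => f (copy u (0 : Fin (0 + 1)))).2 fun u v huv =>
        ⟨fun h => hf.2 _ _ (by simpa only [toCSP, base_copy] using h),
          fun h => hf.1 _ _ (by simpa only [toCSP, base_copy] using ⟨huv, h⟩)⟩
    exact ⟨E, h₁, h₂, _, h₃, fun v => by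
      simpa only [base_copy] using hl (copy v (0 : Fin (0 + 1)))⟩

/-! ### From structures to sandwich instances -/

variable {m : ℕ} {c : ℕ → ℕ → Bool}

/-- The sandwich instance on the copies of the vertices of a structure. Copies of `u` and `v` form
an edge if `uv` is only blue, a non-edge if `uv` is only red, and follow the pattern `c` if `uv` is
both red and blue. -/
def CSPInstance.toSandwich (m : ℕ) {c : ℕ → ℕ → Bool} (hc : ∀ i j, c i j = c j i)
    (I : CSPInstance) : SandwichInstance where
  k := I.k * (m + 1)
  lower :=
    { Adj := fun x y => x ≠ y ∧
        (I.str.blue (base x) (base y) ∨ I.str.blue (base y) (base x)) ∧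
        ((I.str.red (base x) (base y) ∨ I.str.red (base y) (base x)) → c (idx x) (idx y) = true)
      symm := ⟨fun x y h => ⟨h.1.symm, h.2.1.symm, fun h' => hc _ _ ▸ h.2.2 h'.symm⟩⟩
      loopless := ⟨fun x h => h.1 rfl⟩ }
  upper :=
    { Adj := fun x y => x ≠ y ∧
        ¬ ((I.str.red (base x) (base y) ∨ I.str.red (base y) (base x)) ∧
        ((I.str.blue (base x) (base y) ∨ I.str.blue (base y) (base x)) →
          c (idx x) (idx y) = false))
      symm := ⟨fun x y h => ⟨h.1.symm, fun h' => h.2 ⟨h'.1.symm, fun h'' =>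
        hc _ _ ▸ h'.2 h''.symm⟩⟩⟩
      loopless := ⟨fun x h => h.1 rfl⟩ }
  lower_le_upper x y h := ⟨h.1, fun h' => by
    have h₁ := h.2.2 h'.1
    have h₂ := h'.2 h.2.1
    exact Bool.false_ne_true (h₂.symm.trans h₁)⟩

/-- The effect of `CSPInstance.toSandwich` on matrix entries. -/
def toSandwichEntry (c : ℕ → ℕ → Bool) (i j : ℕ) :
    Bool × (Bool × Bool) × (Bool × Bool) → Bool × Bool × Bool
  | (e, (r, r'), (b, b')) =>
    (e && i == j,
      !(e && i == j) && ((b || b') && (!(r || r') || c i j)),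
      !(e && i == j) && !((r || r') && (!(b || b') || !c i j)))

theorem CSPInstance.entry_toSandwich (hc : ∀ i j, c i j = c j i) (I : CSPInstance)
    (x y : Fin (I.k * (m + 1))) :
    (I.toSandwich m hc).entry x y = toSandwichEntry c (idx x) (idx y) (I.entry (base x) (base y)) := by
  have h : x = y ↔ base x = base y ∧ (idx x : ℕ) = (idx y : ℕ) := by
    rw [eq_iff, Fin.ext_iff (a := idx x)]
  refine SandwichInstance.entry_eq (h.trans (by simp)) ?_ ?_
  · change x ≠ y ∧ _ ∧ _ ↔ _
    rw [Ne, h]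
    simp only [Bool.and_eq_true, Bool.or_eq_true, Bool.not_eq_true', Bool.and_eq_false_iff,
      Bool.or_eq_false_iff, decide_eq_true_eq, decide_eq_false_iff_not, beq_eq_false_iff_ne]
    tauto
  · change x ≠ y ∧ ¬ (_ ∧ _) ↔ _
    rw [Ne, h]
    simp only [Bool.and_eq_true, Bool.or_eq_true, Bool.not_eq_true', Bool.and_eq_false_iff,
      Bool.or_eq_false_iff, decide_eq_true_eq, decide_eq_false_iff_not, beq_eq_false_iff_ne,
      Bool.not_eq_false']
    cases c (idx x) (idx y) <;> tauto

/-- A homomorphism is lifted by giving all copies of a vertex its value. Conversely, `sel` picks a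
value for each vertex from the colouring of its own copies alone, so one choice serves all
constraints at once. Loops need no separate treatment, since `hsel` allows `φ = ψ` and supplies `i ≠
j`. -/
theorem CSPInstance.exists_iff_toSandwich (hM : M.IsSymm) (hc : ∀ i j, c i j = c j i)
    {sel : (Fin (m + 1) → Fin n) → Fin n}
    (hsel : ∀ φ ψ b, ∃ i j : Fin (m + 1), i ≠ j ∧ φ i = sel φ ∧ ψ j = sel ψ ∧ c i j = b)
    (I : CSPInstance) (l : Fin I.k → Set (Fin n)) :
    (∃ f : Fin I.k → Fin n, I.str.IsHom (colouredGraph M) f ∧ ∀ v, f v ∈ l v) ↔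
      ∃ E, (I.toSandwich m hc).lower ≤ E ∧ E ≤ (I.toSandwich m hc).upper ∧
        ∃ f, IsPartition M E f ∧ ∀ x, f x ∈ l (base x) := by
  constructor
  · rintro ⟨f, hf, hl⟩
    obtain ⟨E, h₁, h₂, h₃⟩ := (exists_sandwich_iff hM (I.toSandwich m hc).lower_le_upper
      fun x => f (base x)).2 fun x y hxy => ⟨fun h => h.2.1.elim (hf.2 _ _)
        fun h' => blue_comm hM (hf.2 _ _ h'), fun h => (not_and_not_right.1 h hxy).1.elim
          (hf.1 _ _) fun h' => red_comm hM (hf.1 _ _ h')⟩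
    exact ⟨E, h₁, h₂, _, h₃, fun x => hl _⟩
  · rintro ⟨E, h₁, h₂, (F : Fin (I.k * (m + 1)) → Fin n), hF, hl⟩
    have h := (exists_sandwich_iff hM (I.toSandwich m hc).lower_le_upper F).1 ⟨E, h₁, h₂, hF⟩
    have hne : ∀ {u v : Fin I.k} {i j : Fin (m + 1)}, i ≠ j → copy u i ≠ copy v j :=
      fun hij e => hij (by simpa using congrArg idx e)
    refine ⟨fun u => sel fun i => F (copy u i), ⟨fun u v huv => ?_, fun u v huv => ?_⟩, fun u => ?_⟩
    -- Copies with pattern value `false` form a forced non-edge whenever `u v` is red, whether or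
    -- not it is also blue; dually for `true` and blue below.
    · obtain ⟨i, j, hij, hi, hj, hb⟩ := hsel (fun i => F (copy u i)) (fun i => F (copy v i)) false
      have key : (colouredGraph M).red (F (copy u i)) (F (copy v j)) :=
        (h (copy u i) (copy v j) (hne hij)).2 fun h' => h'.2 <| by
          simp only [base_copy, idx_copy]
          exact ⟨Or.inl huv, fun _ => hb⟩
      rwa [hi, hj] at key
    · obtain ⟨i, j, hij, hi, hj, hb⟩ := hsel (fun i => F (copy u i)) (fun i => F (copy v i)) true
      have key : (colouredGraph M).blue (F (copy u i)) (F (copy v j)) :=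
        (h (copy u i) (copy v j) (hne hij)).1 ⟨hne hij, by
          simp only [base_copy, idx_copy]
          exact ⟨Or.inl huv, fun _ => hb⟩⟩
      rwa [hi, hj] at key
    -- Only the fact that the selected value occurs on some copy is used; the colour is arbitrary.
    · obtain ⟨i, -, -, hi, -⟩ := hsel (fun i => F (copy u i)) (fun i => F (copy u i)) true
      have key := hl (copy u i)
      rwa [base_copy, hi] at key

/-! ### The four polynomial-time reductions -/

theorem sandwichProblem_reduces_csp (hM : M.IsSymm) :
    PolyTimeReduces (sandwichProblem M) (csp (colouredGraph M)) :=
  ⟨SandwichInstance.toCSP,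
    Blowup.computable (fun _ _ => toCSPEntry) (fun I : SandwichInstance => I.k) (fun _ _ => ())
      SandwichInstance.entry _ _ (fun I => I.toCSP.entry) (fun _ => rfl)
      SandwichInstance.entry_toCSP,
    fun I => by
      simpa [sandwichProblem, csp] using I.exists_iff_toCSP hM fun _ => Set.univ⟩

theorem listSandwichProblem_reduces_listCsp (hM : M.IsSymm) :
    PolyTimeReduces (listSandwichProblem M) (listCsp (colouredGraph M)) :=
  ⟨fun I => ⟨I.toCSP, fun x => I.list (base x)⟩,
    Blowup.computable (fun _ _ => toCSPEntry) (fun I : ListSandwichInstance n => I.k)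
      ListSandwichInstance.list (fun I => I.entry) _ _ (fun I => I.toCSP.entry) (fun _ => rfl)
      fun I => I.entry_toCSP,
    fun I => I.exists_iff_toCSP hM fun v => (I.list v : Set (Fin n))⟩

theorem csp_reduces_sandwichProblem (hM : M.IsSymm) :
    PolyTimeReduces (csp (colouredGraph M)) (sandwichProblem M) := by
  obtain ⟨m, c, sel, hc, hsel⟩ := exists_pattern n
  exact ⟨CSPInstance.toSandwich m hc,
    Blowup.computable (toSandwichEntry c) (fun I : CSPInstance => I.k) (fun _ _ => ())
      CSPInstance.entry _ _ (fun I => (I.toSandwich m hc).entry) (fun _ => rfl)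
      (CSPInstance.entry_toSandwich hc),
    fun I => by
      simpa [sandwichProblem, csp] using I.exists_iff_toSandwich hM hc hsel fun _ => Set.univ⟩

theorem listCsp_reduces_listSandwichProblem (hM : M.IsSymm) :
    PolyTimeReduces (listCsp (colouredGraph M)) (listSandwichProblem M) := by
  obtain ⟨m, c, sel, hc, hsel⟩ := exists_pattern n
  exact ⟨fun I => ⟨I.toSandwich m hc, fun x => I.list (base x)⟩,
    Blowup.computable (toSandwichEntry c) (fun I : ListCSPInstance n => I.k)
      ListCSPInstance.list (fun I => I.entry) _ _ (fun I => (I.toSandwich m hc).entry)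
      (fun _ => rfl) fun I => I.entry_toSandwich hc,
    fun I => I.exists_iff_toSandwich hM hc hsel fun v => (I.list v : Set (Fin n))⟩

end Reductions

end MatrixSandwich

theorem mainTheorem7 (n : ℕ) (M : Matrix (Fin n) (Fin n) MatrixSandwich.Entry) (hM : M.IsSymm) :
    MatrixSandwich.PolyTimeEquivalent (MatrixSandwich.sandwichProblem M)
      (MatrixSandwich.csp (MatrixSandwich.colouredGraph M)) ∧
    MatrixSandwich.PolyTimeEquivalent (MatrixSandwich.listSandwichProblem M)
      (MatrixSandwich.listCsp (MatrixSandwich.colouredGraph M)) :=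
  ⟨⟨MatrixSandwich.sandwichProblem_reduces_csp hM, MatrixSandwich.csp_reduces_sandwichProblem hM⟩,
    ⟨MatrixSandwich.listSandwichProblem_reduces_listCsp hM,
      MatrixSandwich.listCsp_reduces_listSandwichProblem hM⟩⟩
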